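/- Theorem (Flatness theorem). Let $n\ge 0$ and let $(M,g)$ be a smooth Riemannian manifold of dimension $n$ without boundary (connectedness is not needed). Let $\nabla$ be its Levi-Civita connection, i.e. the unique affine connection on $TM$ that is compatible with the metric, $X\langle Y,Z\rangle_g=\langle\nabla_XY,Z\rangle_g+\langle Y,\nabla_XZ\rangle_g$, and torsion-free, $\nabla_XY-\nabla_YX=[X,Y]$. Then the following are equivalent. (i) $(M,g)$ is locally isometric to Euclidean space: every point of $M$ has an open neighbourhood $U$ for which there is a smooth diffeomorphism $\varphi$ from $U$ onto an open subset of $\mathbb{R}^n$ with $\langle d\varphi_y v,d\varphi_y w\rangle_{\mathbb{R}^n}=\langle v,w\rangle_g$ for all $y\in U$ and $v,w\in T_yM$. (ii) The curvature of $\nabla$ vanishes: $R(X,Y)Z=\nabla_X\nabla_YZ-\nabla_Y\nabla_XZ-\nabla_{[X,Y]}Z=0$ for all smooth vector fields $X,Y,Z$. -/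

import Mathlib

set_option linter.unusedSectionVars false

open Bundle Manifold NormedSpace
open scoped ContDiff

noncomputable section
namespace RiemannianFlatness

section LeviCivita

variable {E : Type*} [NormedAddCommGroup E] [NormedSpace ℝ E]
  {H : Type*} [TopologicalSpace H] {I : ModelWithCorners ℝ E H}
  {M : Type*} [TopologicalSpace M] [ChartedSpace H M] [IsManifold I 2 M]
  [RiemannianBundle (fun x : M ↦ TangentSpace I x)]
  [IsContMDiffRiemannianBundle I 1 E (fun x : M ↦ TangentSpace I x)]

/-- The right-hand side of the Koszul formula,
`½ (X⟨Y,Z⟩ + Y⟨Z,X⟩ - Z⟨X,Y⟩ + ⟨[X,Y],Z⟩ - ⟨[Y,Z],X⟩ - ⟨[X,Z],Y⟩)`. It is only used in the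
proof that the Levi-Civita connection exists and is unique. -/
def koszul (I : ModelWithCorners ℝ E H) [RiemannianBundle (fun x : M ↦ TangentSpace I x)]
    (X Y Z : Π x : M, TangentSpace I x) (x : M) : ℝ :=
  (d% (fun y ↦ (inner ℝ (Y y) (Z y) : ℝ)) x (X x) + d% (fun y ↦ (inner ℝ (Z y) (X y) : ℝ)) x (Y x)
    - d% (fun y ↦ (inner ℝ (X y) (Y y) : ℝ)) x (Z x)
    + inner ℝ (VectorField.mlieBracket I X Y x) (Z x)
    - inner ℝ (VectorField.mlieBracket I Y Z x) (X x)
    - inner ℝ (VectorField.mlieBracket I X Z x) (Y x)) / 2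

variable {X X' Y Y' Z Z' : Π x : M, TangentSpace I x} {f : M → ℝ} {x : M}

lemma mdiff_inner (hY : MDiffAt (T% Y) x) (hZ : MDiffAt (T% Z) x) :
    MDiffAt (fun y ↦ (inner ℝ (Y y) (Z y) : ℝ)) x :=
  MDifferentiableAt.inner_bundle (F := E) (E := fun x : M ↦ TangentSpace I x) (b := id) hY hZ

lemma dinner_smul_left (hf : MDiffAt f x) (hY : MDiffAt (T% Y) x) (hZ : MDiffAt (T% Z) x) :
    d% (fun y ↦ (inner ℝ ((f • Y) y) (Z y) : ℝ)) x =
      f x • d% (fun y ↦ (inner ℝ (Y y) (Z y) : ℝ)) x + (inner ℝ (Y x) (Z x) : ℝ) • d% f x := by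
  simp [inner_smul_left, mvfderiv_fun_mul hf (mdiff_inner hY hZ)]

lemma dinner_comm :
    d% (fun y ↦ (inner ℝ (Y y) (Z y) : ℝ)) x = d% (fun y ↦ (inner ℝ (Z y) (Y y) : ℝ)) x := by
  congr 1; funext y; exact real_inner_comm _ _

lemma dinner_smul_right (hf : MDiffAt f x) (hY : MDiffAt (T% Y) x) (hZ : MDiffAt (T% Z) x) :
    d% (fun y ↦ (inner ℝ (Y y) ((f • Z) y) : ℝ)) x =
      f x • d% (fun y ↦ (inner ℝ (Y y) (Z y) : ℝ)) x + (inner ℝ (Y x) (Z x) : ℝ) • d% f x := by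
  simp [inner_smul_right, mvfderiv_fun_mul hf (mdiff_inner hY hZ)]

lemma dinner_add_left (hY : MDiffAt (T% Y) x) (hY' : MDiffAt (T% Y') x)
    (hZ : MDiffAt (T% Z) x) :
    d% (fun y ↦ (inner ℝ ((Y + Y') y) (Z y) : ℝ)) x =
      d% (fun y ↦ (inner ℝ (Y y) (Z y) : ℝ)) x + d% (fun y ↦ (inner ℝ (Y' y) (Z y) : ℝ)) x := by
  simp [inner_add_left, mvfderiv_fun_add (mdiff_inner hY hZ) (mdiff_inner hY' hZ)]

lemma dinner_add_right (hY : MDiffAt (T% Y) x) (hZ : MDiffAt (T% Z) x)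
    (hZ' : MDiffAt (T% Z') x) :
    d% (fun y ↦ (inner ℝ (Y y) ((Z + Z') y) : ℝ)) x =
      d% (fun y ↦ (inner ℝ (Y y) (Z y) : ℝ)) x + d% (fun y ↦ (inner ℝ (Y y) (Z' y) : ℝ)) x := by
  simp [inner_add_right, mvfderiv_fun_add (mdiff_inner hY hZ) (mdiff_inner hY hZ')]

variable [FiniteDimensional ℝ E]

lemma koszul_left (hY : MDiffAt (T% Y) x) (hZ : MDiffAt (T% Z) x) :
    TensorialAt I E (fun X ↦ koszul I X Y Z x) x where
  smul {f X} hf hX := by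
    simp only [koszul, dinner_smul_left hf hX hY, dinner_smul_right hf hZ hX,
      VectorField.mlieBracket_smul_left hf hX]
    simp [inner_add_left, inner_smul_left, inner_smul_right, real_inner_comm]
    ring
  add hX hX' := by
    simp only [koszul, dinner_add_left hX hX' hY, dinner_add_right hZ hX hX',
      VectorField.mlieBracket_add_left hX hX']
    simp [inner_add_left, inner_add_right]
    ring

lemma koszul_right (hX : MDiffAt (T% X) x) (hY : MDiffAt (T% Y) x) :
    TensorialAt I E (fun Z ↦ koszul I X Y Z x) x where
  smul {f Z} hf hZ := by
    simp only [koszul, dinner_smul_left hf hZ hX, dinner_smul_right hf hY hZ,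
      VectorField.mlieBracket_smul_right hf hZ]
    simp [inner_add_left, inner_smul_left, inner_smul_right, real_inner_comm]
    ring
  add hZ hZ' := by
    simp only [koszul, dinner_add_left hZ hZ' hX, dinner_add_right hY hZ hZ',
      VectorField.mlieBracket_add_right hZ hZ']
    simp [inner_add_left, inner_add_right]
    ring

lemma koszul_add (hX : MDiffAt (T% X) x) (hY : MDiffAt (T% Y) x) (hY' : MDiffAt (T% Y') x)
    (hZ : MDiffAt (T% Z) x) :
    koszul I X (Y + Y') Z x = koszul I X Y Z x + koszul I X Y' Z x := by
  simp only [koszul, dinner_add_left hY hY' hZ, dinner_add_right hX hY hY',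
    VectorField.mlieBracket_add_right hY hY', VectorField.mlieBracket_add_left hY hY']
  simp [inner_add_left, inner_add_right]
  ring

lemma koszul_smul (hf : MDiffAt f x) (hX : MDiffAt (T% X) x) (hY : MDiffAt (T% Y) x)
    (hZ : MDiffAt (T% Z) x) :
    koszul I X (f • Y) Z x = f x * koszul I X Y Z x + d% f x (X x) * inner ℝ (Y x) (Z x) := by
  simp only [koszul, dinner_smul_left hf hY hZ, dinner_smul_right hf hX hY,
    VectorField.mlieBracket_smul_right hf hY, VectorField.mlieBracket_smul_left hf hY]
  simp [inner_add_left, inner_smul_left, inner_smul_right, real_inner_comm]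
  ring

lemma exists_riesz {V : Type*} [NormedAddCommGroup V] [InnerProductSpace ℝ V]
    [FiniteDimensional ℝ V] (B : V →ₗ[ℝ] V →ₗ[ℝ] ℝ) :
    ∃ A : V →ₗ[ℝ] V, ∀ v w, inner ℝ (A v) w = B v w := by
  have : CompleteSpace V := FiniteDimensional.complete ℝ V
  refine ⟨{ toFun v := (InnerProductSpace.toDual ℝ V).symm (LinearMap.toContinuousLinearMap (B v))
            map_add' := by simp
            map_smul' := by simp }, fun v w ↦ by simp⟩

lemma exists_koszul_op (Y : Π x : M, TangentSpace I x) (x : M) :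
    ∃ A : TangentSpace I x →L[ℝ] TangentSpace I x, MDiffAt (T% Y) x →
      ∀ X Z : Π x : M, TangentSpace I x, MDiffAt (T% X) x → MDiffAt (T% Z) x →
        inner ℝ (A (X x)) (Z x) = koszul I X Y Z x := by
  by_cases hY : MDiffAt (T% Y) x
  · let B := TensorialAt.mkHom₂ (F := E) (F' := E) (I := I) (fun X Z ↦ koszul I X Y Z x) x
      (fun Z hZ ↦ koszul_left hY hZ) (fun X hX ↦ koszul_right hX hY)
    have : FiniteDimensional ℝ (TangentSpace I x) := inferInstanceAs (FiniteDimensional ℝ E)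
    have : T2Space (TangentSpace I x) := inferInstanceAs (T2Space E)
    obtain ⟨A, hA⟩ := exists_riesz (V := TangentSpace I x)
      (LinearMap.mk₂ ℝ (fun v w ↦ B v w) (by simp) (by simp) (by simp) (by simp))
    refine ⟨(LinearMap.toContinuousLinearMap (𝕜 := ℝ) (E := TangentSpace I x)
      (F' := TangentSpace I x) A : TangentSpace I x →L[ℝ] TangentSpace I x), fun _ X Z hX hZ ↦ ?_⟩
    refine (hA _ _).trans ?_
    exact TensorialAt.mkHom₂_apply (F := E) (F' := E) (I := I)
      (fun Z hZ ↦ koszul_left hY hZ) (fun X hX ↦ koszul_right hX hY) hX hZ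
  · exact ⟨0, fun h ↦ absurd h hY⟩

/-- An affine connection `∇` on the tangent bundle of a Riemannian manifold is a *Levi-Civita
connection* if it is compatible with the metric, `X⟨Y,Z⟩ = ⟨∇_X Y,Z⟩ + ⟨Y,∇_X Z⟩`, and its torsion
`T(X,Y) = ∇_X Y - ∇_Y X - [X,Y]` vanishes. Here `cov Y x (X x)` is `∇_X Y` at `x`. -/
def IsLeviCivita (cov : CovariantDerivative I E (fun x : M ↦ TangentSpace I x)) : Prop :=
  (∀ (X Y Z : Π x : M, TangentSpace I x) (x : M),
    MDiffAt (T% X) x → MDiffAt (T% Y) x → MDiffAt (T% Z) x →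
      d% (fun y ↦ (inner ℝ (Y y) (Z y) : ℝ)) x (X x) =
        inner ℝ (cov Y x (X x)) (Z x) + inner ℝ (Y x) (cov Z x (X x))) ∧
  cov.torsion = 0

lemma ext_inner' {u v : TangentSpace I x} (h : ∀ w : TangentSpace I x, inner ℝ u w = inner ℝ v w) :
    u = v := ext_inner_right ℝ h

lemma mdiff_extend (v : TangentSpace I x) :
    MDiffAt (T% (FiberBundle.extend E v : Π y : M, TangentSpace I y)) x :=
  FiberBundle.mdifferentiableAt_extend ..

/-- Existence of the Levi-Civita connection. -/
lemma exists_isLeviCivita :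
    ∃ cov : CovariantDerivative I E (fun x : M ↦ TangentSpace I x), IsLeviCivita cov := by
  choose A hA using exists_koszul_op (I := I) (M := M)
  have key : ∀ {Y : Π x : M, TangentSpace I x} {x : M}, MDiffAt (T% Y) x →
      ∀ v w : TangentSpace I x, inner ℝ (A Y x v) w =
        koszul I (FiberBundle.extend E v) Y (FiberBundle.extend E w) x := by
    intro Y x hY v w
    have := hA Y x hY _ _ (mdiff_extend v) (mdiff_extend w)
    simpa using this
  have hadd {σ σ' : Π x : M, TangentSpace I x} {x : M} (hσ : MDiffAt (T% σ) x)
      (hσ' : MDiffAt (T% σ') x) : A (σ + σ') x = A σ x + A σ' x := by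
    ext v
    refine ext_inner' fun w ↦ ?_
    rw [add_apply, inner_add_left, key hσ, key hσ',
      key (mdifferentiableAt_add_section hσ hσ'),
      koszul_add (mdiff_extend v) hσ hσ' (mdiff_extend w)]
  have hleib {σ : Π x : M, TangentSpace I x} {g : M → ℝ} {x : M} (hσ : MDiffAt (T% σ) x)
      (hg : MDiffAt g x) : A (g • σ) x = g x • A σ x + (d% g x).smulRight (σ x) := by
    ext v
    refine ext_inner' fun w ↦ ?_
    rw [key (hg.smul_section hσ), koszul_smul hg (mdiff_extend v) hσ (mdiff_extend w)]
    simp [inner_add_left, inner_smul_left, key hσ]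
  refine ⟨⟨A, ⟨fun h h' _ ↦ hadd h h', fun h h' _ ↦ hleib h h'⟩⟩, ?_, ?_⟩
  · intro X Y Z x hX hY hZ
    change _ = inner ℝ (A Y x (X x)) (Z x) + inner ℝ (Y x) (A Z x (X x))
    rw [real_inner_comm _ (Y x), hA Y x hY X Z hX hZ, hA Z x hZ X Y hX hY]
    simp only [koszul, VectorField.mlieBracket_swap_apply (V := Z) (W := Y),
      dinner_comm (Y := Z) (Z := Y), dinner_comm (Y := Y) (Z := X), dinner_comm (Y := Z) (Z := X)]
    simp [inner_neg_left]
    ring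
  · rw [CovariantDerivative.torsion_eq_zero_iff]
    intro X Y x hX hY
    change A Y x (X x) - A X x (Y x) = _
    refine ext_inner' fun w ↦ ?_
    have hw := mdiff_extend w
    obtain ⟨W, hW, rfl⟩ : ∃ W : Π y : M, TangentSpace I y, MDiffAt (T% W) x ∧ W x = w :=
      ⟨_, hw, by simp⟩
    rw [inner_sub_left, hA Y x hY X W hX hW, hA X x hX Y W hY hW]
    simp only [koszul, VectorField.mlieBracket_swap_apply (V := Y) (W := X),
      dinner_comm (Y := Y) (Z := X), dinner_comm (Y := W) (Z := Y), dinner_comm (Y := W) (Z := X)]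
    simp [inner_neg_left]
    ring

/-- Uniqueness of the Levi-Civita connection: two Levi-Civita connections agree on every vector
field that is differentiable at the point. -/
lemma IsLeviCivita.unique {cov cov' : CovariantDerivative I E (fun x : M ↦ TangentSpace I x)}
    (h : IsLeviCivita cov) (h' : IsLeviCivita cov') (hY : MDiffAt (T% Y) x) :
    cov Y x = cov' Y x := by
  have key : ∀ c : CovariantDerivative I E (fun x : M ↦ TangentSpace I x), IsLeviCivita c →
      ∀ X Z : Π x : M, TangentSpace I x, MDiffAt (T% X) x → MDiffAt (T% Z) x →
        inner ℝ (c Y x (X x)) (Z x) = koszul I X Y Z x := by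
    intro c hc X Z hX hZ
    have t {X Y : Π x : M, TangentSpace I x} (hX : MDiffAt (T% X) x) (hY : MDiffAt (T% Y) x) :=
      c.torsion_eq_zero_iff.1 hc.2 hX hY
    rw [koszul, hc.1 X Y Z x hX hY hZ, hc.1 Y Z X x hY hZ hX, hc.1 Z X Y x hZ hX hY,
      ← t hX hY, ← t hY hZ, ← t hX hZ]
    simp only [inner_sub_left]
    simp only [real_inner_comm]
    ring
  ext v
  refine ext_inner' fun w ↦ ?_
  have := (key cov h _ _ (mdiff_extend v) (mdiff_extend w)).trans
    (key cov' h' _ _ (mdiff_extend v) (mdiff_extend w)).symm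
  simpa using this

/-- The Levi-Civita connection of a smooth Riemannian manifold `M`. -/
def leviCivita (I : ModelWithCorners ℝ E H) (M : Type*) [TopologicalSpace M] [ChartedSpace H M]
    [IsManifold I ∞ M] [RiemannianBundle (fun x : M ↦ TangentSpace I x)]
    [IsContMDiffRiemannianBundle I ∞ E (fun x : M ↦ TangentSpace I x)] :
    CovariantDerivative I E (fun x : M ↦ TangentSpace I x) :=
  (exists_isLeviCivita (I := I) (M := M)).choose

lemma isLeviCivita_leviCivita (I : ModelWithCorners ℝ E H) (M : Type*) [TopologicalSpace M]
    [ChartedSpace H M] [IsManifold I ∞ M] [RiemannianBundle (fun x : M ↦ TangentSpace I x)]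
    [IsContMDiffRiemannianBundle I ∞ E (fun x : M ↦ TangentSpace I x)] :
    IsLeviCivita (leviCivita I M) :=
  (exists_isLeviCivita (I := I) (M := M)).choose_spec

end LeviCivita

section Curvature

variable {E : Type*} [NormedAddCommGroup E] [NormedSpace ℝ E]
  {H : Type*} [TopologicalSpace H] {I : ModelWithCorners ℝ E H}
  {M : Type*} [TopologicalSpace M] [ChartedSpace H M]

variable [IsManifold I 1 M]

/-- The curvature `R(X,Y)Z = ∇_X ∇_Y Z - ∇_Y ∇_X Z - ∇_{[X,Y]} Z` of an affine connection. -/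
def curvature (cov : CovariantDerivative I E (fun x : M ↦ TangentSpace I x))
    (X Y Z : Π x : M, TangentSpace I x) (x : M) : TangentSpace I x :=
  cov (fun y ↦ cov Z y (Y y)) x (X x) - cov (fun y ↦ cov Z y (X y)) x (Y x)
    - cov Z x (VectorField.mlieBracket I X Y x)

/-- The curvature tensor vanishes: `R(X,Y)Z = 0` at every point `x`, for all vector fields
`X, Y, Z` that are smooth at `x`. -/
def CurvatureVanishes
    (cov : CovariantDerivative I E (fun x : M ↦ TangentSpace I x)) : Prop :=
  ∀ (x : M) (X Y Z : Π y : M, TangentSpace I y),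
    CMDiffAt ∞ (T% X) x → CMDiffAt ∞ (T% Y) x → CMDiffAt ∞ (T% Z) x →
      curvature cov X Y Z x = 0

end Curvature

section LocalIsometry

variable {E : Type*} [NormedAddCommGroup E] [NormedSpace ℝ E]
  {H : Type*} [TopologicalSpace H] (I : ModelWithCorners ℝ E H)
  (M : Type*) [TopologicalSpace M] [ChartedSpace H M]
  [RiemannianBundle (fun x : M ↦ TangentSpace I x)]
  {E' : Type*} [NormedAddCommGroup E'] [NormedSpace ℝ E']
  {H' : Type*} [TopologicalSpace H'] (J : ModelWithCorners ℝ E' H')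
  (N : Type*) [TopologicalSpace N] [ChartedSpace H' N]
  [RiemannianBundle (fun x : N ↦ TangentSpace J x)]

/-- The Riemannian manifold `M` is locally isometric to the Riemannian manifold `N`: every point
of `M` has an open neighbourhood which a smooth diffeomorphism, preserving the inner products of
tangent vectors, maps onto an open subset of `N`. -/
def IsLocallyIsometricTo : Prop :=
  ∀ x : M, ∃ e : OpenPartialHomeomorph M N, x ∈ e.source ∧
    ContMDiffOn I J ∞ e e.source ∧ ContMDiffOn J I ∞ e.symm e.target ∧
    ∀ y ∈ e.source, ∀ v w : TangentSpace I y,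
      inner ℝ (mfderiv I J e y v) (mfderiv I J e y w) = inner ℝ v w

end LocalIsometry

end RiemannianFlatness

end

noncomputable section
namespace RiemannianFlatness

open Set Filter Metric Topology

set_option maxSynthPendingDepth 3
set_option synthInstance.maxHeartbeats 100000

section LinearODE

lemma norm_le_gronwallBound_one {F : Type*} [NormedAddCommGroup F] [NormedSpace ℝ F]
    {f f' : ℝ → F} {K ε : ℝ}
    (hf : ∀ t ∈ Icc (0 : ℝ) 1, HasDerivWithinAt f (f' t) (Icc 0 1) t)
    (bound : ∀ t ∈ Icc (0 : ℝ) 1, ‖f' t‖ ≤ K * ‖f t‖ + ε) {t : ℝ} (ht : t ∈ Icc (0 : ℝ) 1) :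
    ‖f t‖ ≤ gronwallBound ‖f 0‖ K ε t := by
  have := norm_le_gronwallBound_of_norm_deriv_right_le (f := f) (f' := f') (δ := ‖f 0‖) (K := K)
    (ε := ε) (a := 0) (b := 1) (fun t ht ↦ (hf t ht).continuousWithinAt)
    (fun t ht ↦ ?_) le_rfl (fun t ht ↦ bound t ⟨ht.1, ht.2.le⟩) t ht
  · simpa using this
  · exact (hf t ⟨ht.1, ht.2.le⟩).mono_of_mem_nhdsWithin
      (mem_of_superset (Icc_mem_nhdsGE ht.2) (Icc_subset_Icc_left ht.1))

variable {𝔸 : Type*} [NormedRing 𝔸] [NormedAlgebra ℝ 𝔸] [CompleteSpace 𝔸]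

lemma exists_linear_ode (h1 : ‖(1 : 𝔸)‖ ≤ 1) {a : ℝ → 𝔸} (ha : ContinuousOn a (Icc 0 1))
    (hC : ∀ t ∈ Icc (0 : ℝ) 1, ‖a t‖ ≤ 1 / 4) :
    ∃ p : ℝ → 𝔸, p 0 = 1 ∧ (∀ t ∈ Icc (0 : ℝ) 1, HasDerivWithinAt p (p t * a t) (Icc 0 1) t) ∧
      ∀ t ∈ Icc (0 : ℝ) 1, ‖p t‖ ≤ 3 := by
  have key : IsPicardLindelof (fun t y ↦ y * a t) (tmin := 0) (tmax := 1)
      ⟨0, by simp⟩ (1 : 𝔸) 1 0 1 1 := by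
    refine ⟨fun t ht ↦ ?_, fun x _ ↦ continuousOn_const.mul ha, fun t ht x hx ↦ ?_, by simp⟩
    · refine LipschitzWith.lipschitzOnWith (LipschitzWith.of_dist_le_mul fun x y ↦ ?_)
      rw [dist_eq_norm, dist_eq_norm, ← sub_mul]
      refine (norm_mul_le _ _).trans ?_
      have := hC t ht
      have := norm_nonneg (x - y)
      simp only [NNReal.coe_one]; nlinarith
    · have hx' : ‖x‖ ≤ 2 := by
        have : ‖x - 1‖ ≤ 1 := by simpa [dist_eq_norm] using hx
        have := norm_add_le (x - 1) 1
        simp only [sub_add_cancel] at this; linarith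
      refine (norm_mul_le _ _).trans ?_
      have := hC t ht
      have := norm_nonneg x
      simp only [NNReal.coe_one]; nlinarith [norm_nonneg (a t)]
  obtain ⟨p, hp0, hp⟩ := key.exists_eq_forall_mem_Icc_hasDerivWithinAt₀
  refine ⟨p, hp0, hp, fun t ht ↦ ?_⟩
  have := norm_le_gronwallBound_one (K := 1 / 4) (ε := 0) hp (fun t ht ↦ ?_) ht
  · refine this.trans ?_
    have hp0' : p 0 = 1 := hp0
    rw [gronwallBound_ε0, hp0']
    have : Real.exp (1 / 4 * t) ≤ Real.exp 1 := Real.exp_le_exp.2 (by linarith [ht.2])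
    have := Real.exp_one_lt_d9
    have := Real.exp_pos (1 / 4 * t)
    nlinarith [norm_nonneg (1 : 𝔸)]
  · refine (norm_mul_le _ _).trans ?_
    have := hC t ht
    have := norm_nonneg (p t)
    nlinarith

end LinearODE

section Frobenius

variable {E : Type*} [NormedAddCommGroup E] [NormedSpace ℝ E]
  {𝔸 : Type*} [NormedRing 𝔸] [NormedAlgebra ℝ 𝔸]

/-- A `C²` function satisfies a uniform second-order Taylor estimate near a point. -/
lemma exists_taylor_estimate {F : Type*} [NormedAddCommGroup F] [NormedSpace ℝ F]
    {A : E → F} {x₀ : E} (hA : ContDiffAt ℝ 2 A x₀) :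
    ∃ C > 0, ∃ r > 0, ∀ u ∈ ball x₀ r, DifferentiableAt ℝ A u ∧ ‖A u‖ ≤ C ∧
      ∀ v ∈ ball x₀ r, ‖A u - A v‖ ≤ C * ‖u - v‖ ∧
        ‖A u - A v - fderiv ℝ A v (u - v)‖ ≤ C * ‖u - v‖ ^ 2 := by
  obtain ⟨K, s, hs, hK⟩ := (hA.of_le one_le_two).exists_lipschitzOnWith
  obtain ⟨K', s', hs', hK'⟩ :=
    (hA.fderiv_right (m := 1) (by norm_num)).exists_lipschitzOnWith
  have hd : ∀ᶠ u in 𝓝 x₀, DifferentiableAt ℝ A u :=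
    (hA.eventually (by simp)).mono fun u hu ↦ hu.differentiableAt (by simp)
  have hb : ∀ᶠ u in 𝓝 x₀, ‖A u‖ < ‖A x₀‖ + 1 :=
    hA.continuousAt.norm.eventually_lt continuousAt_const (by simp)
  obtain ⟨r, hr, hrs⟩ := Metric.eventually_nhds_iff_ball.1
    (hd.and (hb.and ((eventually_mem_set.2 hs).and (eventually_mem_set.2 hs'))))
  refine ⟨‖A x₀‖ + 1 + K + K', by positivity, r, hr,
    fun u hu ↦ ⟨(hrs u hu).1, ?_, fun v hv ↦ ⟨?_, ?_⟩⟩⟩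
  · have := (hrs u hu).2.1
    linarith [K.coe_nonneg, K'.coe_nonneg]
  · refine (hK.norm_sub_le (hrs u hu).2.2.1 (hrs v hv).2.2.1).trans ?_
    gcongr
    linarith [norm_nonneg (A x₀), K'.coe_nonneg]
  · have hseg : segment ℝ v u ⊆ ball x₀ r := (convex_ball x₀ r).segment_subset hv hu
    have := (convex_segment v u).norm_image_sub_le_of_norm_hasFDerivWithin_le' (f := A)
      (φ := fderiv ℝ A v) (C := K' * ‖u - v‖)
      (fun z hz ↦ (hrs z (hseg hz)).1.hasFDerivAt.hasFDerivWithinAt) (fun z hz ↦ ?_)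
      (left_mem_segment ℝ v u) (right_mem_segment ℝ v u)
    · refine this.trans ?_
      rw [mul_assoc, ← sq]
      gcongr
      linarith [norm_nonneg (A x₀), K.coe_nonneg]
    · refine (hK'.norm_sub_le (hrs z (hseg hz)).2.2.2 (hrs v hv).2.2.2).trans ?_
      gcongr
      obtain ⟨a, b, ha, hb, hab, rfl⟩ := hz
      have : a • v + b • u - v = b • (u - v) := by
        rw [show a = 1 - b by linarith]; module
      rw [this, norm_smul, Real.norm_of_nonneg hb]
      exact mul_le_of_le_one_left (norm_nonneg _) (by linarith)

variable [CompleteSpace 𝔸]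

/-- **Frobenius theorem** for a flat linear connection: if the connection form `A`, with values in
a Banach algebra, satisfies `dA + A ∧ A = 0`, then `dP = P A` has a solution with `P 0 = 1`. -/
lemma exists_parallel_at_zero (h1 : ‖(1 : 𝔸)‖ ≤ 1) {A : E → E →L[ℝ] 𝔸}
    (hA : ContDiffAt ℝ 2 A 0)
    (hflat : ∀ᶠ u in 𝓝 0, ∀ h k : E, fderiv ℝ A u h k + A u h * A u k =
      fderiv ℝ A u k h + A u k * A u h) :
    ∃ P : E → 𝔸, P 0 = 1 ∧
      ∀ᶠ x in 𝓝 0, HasFDerivAt P ((ContinuousLinearMap.mul ℝ 𝔸 (P x)) ∘L A x) x := by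
  obtain ⟨C, hC, r₀, hr₀, hT⟩ := exists_taylor_estimate hA
  obtain ⟨r₁, hr₁, hF⟩ := Metric.eventually_nhds_iff_ball.1 hflat
  set r := min (min r₀ r₁) (min 1 (1 / (4 * C))) with hr
  have hrpos : 0 < r := by positivity
  have hball : ∀ {x : E} {t : ℝ}, x ∈ ball 0 r → t ∈ Icc (0 : ℝ) 1 → t • x ∈ ball 0 r := by
    intro x t hx ht
    rw [mem_ball_zero_iff] at hx ⊢
    rw [norm_smul, Real.norm_of_nonneg ht.1]
    exact (mul_le_of_le_one_left (norm_nonneg _) ht.2).trans_lt hx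
  have hr0 : ∀ {x : E}, x ∈ ball 0 r → x ∈ ball 0 r₀ := fun hx ↦
    ball_subset_ball ((min_le_left _ _).trans (min_le_left _ _)) hx
  have hr1 : ∀ {x : E}, x ∈ ball 0 r → x ∈ ball 0 r₁ := fun hx ↦
    ball_subset_ball ((min_le_left _ _).trans (min_le_right _ _)) hx
  have hx1 : ∀ {x : E}, x ∈ ball 0 r → ‖x‖ ≤ 1 := fun hx ↦
    (mem_ball_zero_iff.1 hx).le.trans ((min_le_right _ _).trans (min_le_left _ _))
  have hxC : ∀ {x : E}, x ∈ ball 0 r → C * ‖x‖ ≤ 1 / 4 := by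
    intro x hx
    have : ‖x‖ ≤ 1 / (4 * C) :=
      (mem_ball_zero_iff.1 hx).le.trans ((min_le_right _ _).trans (min_le_right _ _))
    calc C * ‖x‖ ≤ C * (1 / (4 * C)) := by gcongr
      _ = 1 / 4 := by field_simp
  have hbound : ∀ {x : E}, x ∈ ball 0 r → ∀ t ∈ Icc (0 : ℝ) 1, ‖A (t • x) x‖ ≤ 1 / 4 := by
    intro x hx t ht
    refine ((A (t • x)).le_opNorm x).trans (le_trans ?_ (hxC hx))
    gcongr
    exact (hT _ (hr0 (hball hx ht))).2.1
  have hAray : ∀ {x : E} (k : E), x ∈ ball 0 r → ∀ t ∈ Icc (0 : ℝ) 1,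
      HasDerivWithinAt (fun t : ℝ ↦ A (t • x) k) (fderiv ℝ A (t • x) x k) (Icc 0 1) t := by
    intro x k hx t ht
    have e1 : HasFDerivAt A (fderiv ℝ A (t • x)) (t • x) :=
      (hT _ (hr0 (hball hx ht))).1.hasFDerivAt
    have e2 : HasDerivAt (fun t : ℝ ↦ t • x) x t := by
      simpa using (hasDerivAt_id t).smul_const x
    have e3 := e1.comp_hasDerivAt t e2
    exact (e3.clm_apply (hasDerivAt_const t k)).hasDerivWithinAt.congr_deriv (by simp)
  have hex : ∀ x : E, ∃ p : ℝ → 𝔸, x ∈ ball (0 : E) r → p 0 = 1 ∧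
      (∀ t ∈ Icc (0 : ℝ) 1, HasDerivWithinAt p (p t * A (t • x) x) (Icc 0 1) t) ∧
      ∀ t ∈ Icc (0 : ℝ) 1, ‖p t‖ ≤ 3 := by
    intro x
    by_cases hx : x ∈ ball (0 : E) r
    · obtain ⟨p, hp⟩ := exists_linear_ode h1 (a := fun t ↦ A (t • x) x)
        (fun t ht ↦ (hAray x hx t ht).continuousWithinAt) (hbound hx)
      exact ⟨p, fun _ ↦ hp⟩
    · exact ⟨0, fun h ↦ absurd h hx⟩
  choose p hp using hex
  have h0 : (0 : E) ∈ ball (0 : E) r := mem_ball_self hrpos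
  refine ⟨fun x ↦ p x 1, ?_, ?_⟩
  · obtain ⟨a, b, -⟩ := hp 0 h0
    have := norm_le_gronwallBound_one (f := fun t ↦ p 0 t - 1) (f' := 0) (K := 0) (ε := 0)
      (fun t ht ↦ ((b t ht).sub_const 1).congr_deriv (by simp)) (by simp)
      (right_mem_Icc.2 zero_le_one)
    simpa [a, gronwallBound_ε0, sub_eq_zero] using this
  filter_upwards [ball_mem_nhds (0 : E) hrpos] with x hx
  obtain ⟨px0, px, pxb⟩ := hp x hx
  set D := 1 / (1 / 4) * (Real.exp (1 / 4 * 1) - 1) with hD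
  have key : ∀ y ∈ ball (0 : E) r,
      ‖p y 1 - p x 1 - p x 1 * A x (y - x)‖ ≤
        (3 * (2 * C + C * (2 * C)) * D) * ‖y - x‖ ^ 2 := by
    intro y hy
    obtain ⟨py0, py, -⟩ := hp y hy
    set h := y - x with hh
    set ε := 3 * (2 * C + C * (2 * C)) * ‖h‖ ^ 2 with hε
    have hσ : ∀ t ∈ Icc (0 : ℝ) 1, HasDerivWithinAt (fun t : ℝ ↦ t • A (t • x) h)
        (A (t • x) h + t • fderiv ℝ A (t • x) x h) (Icc 0 1) t := by
      intro t ht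
      exact ((hasDerivWithinAt_id t _).smul (hAray h hx t ht)).congr_deriv (by simp [add_comm])
    have hd : ∀ t ∈ Icc (0 : ℝ) 1, HasDerivWithinAt
        (fun t : ℝ ↦ p y t - p x t * (1 + t • A (t • x) h))
        (p y t * A (t • y) y - (p x t * A (t • x) x * (1 + t • A (t • x) h) +
          p x t * (A (t • x) h + t • fderiv ℝ A (t • x) x h))) (Icc 0 1) t := fun t ht ↦
      (py t ht).sub ((px t ht).mul ((hσ t ht).const_add 1))
    have := norm_le_gronwallBound_one (K := 1 / 4) (ε := ε) hd (fun t ht ↦ ?_)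
      (right_mem_Icc.2 zero_le_one)
    · rw [gronwallBound_of_K_ne_0 (by norm_num)] at this
      simp only [py0, px0, zero_smul, add_zero, mul_one, sub_self, norm_zero, zero_mul, zero_add,
        one_smul] at this
      calc _ = ‖p y 1 - p x 1 * (1 + A x h)‖ := by rw [mul_add, mul_one, sub_sub]
        _ ≤ _ := this
        _ = _ := by rw [hε, hD]; ring
    · have htx := hball hx ht
      have hty := hball hy ht
      obtain ⟨-, hAx, -⟩ := hT _ (hr0 htx)
      obtain ⟨-, -, hAy⟩ := hT _ (hr0 hty)
      obtain ⟨L1, L2⟩ := hAy _ (hr0 htx)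
      have hty' : t • y - t • x = t • h := by rw [hh, smul_sub]
      have hth : ‖t • h‖ ≤ ‖h‖ := by
        rw [norm_smul, Real.norm_of_nonneg ht.1]
        exact mul_le_of_le_one_left (norm_nonneg _) ht.2
      rw [hty'] at L1 L2
      have fl := hF _ (hr1 htx) x h
      have e1 : fderiv ℝ A (t • x) x h = fderiv ℝ A (t • x) h x + A (t • x) h * A (t • x) x
          - A (t • x) x * A (t • x) h := by rw [eq_sub_iff_add_eq, fl]
      set σ := t • A (t • x) h with hσdef
      set R := (A (t • y) - A (t • x) - fderiv ℝ A (t • x) (t • h)) x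
        + (A (t • y) - A (t • x)) h with hR
      set Q := (A (t • y) - A (t • x)) y + A (t • x) h with hQ
      have hyx : y = x + h := by simp [hh]
      have eQ : A (t • y) y - A (t • x) x = Q := by
        simp only [hQ, hyx, map_add, sub_apply]; abel
      have eR : Q = R + A (t • x) h + t • fderiv ℝ A (t • x) h x := by
        simp only [hQ, hR, hyx, map_add, map_smul, sub_apply, smul_apply]; abel
      have main : p y t * A (t • y) y - (p x t * A (t • x) x * (1 + σ) +
          p x t * (A (t • x) h + t • fderiv ℝ A (t • x) x h)) =
          (p y t - p x t * (1 + σ)) * A (t • y) y + p x t * (R + σ * Q) := by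
        have e2 : A (t • y) y = A (t • x) x + Q := by rw [← eQ]; abel
        have e3 : t • fderiv ℝ A (t • x) x h = (Q - R - A (t • x) h) + σ * A (t • x) x
            - A (t • x) x * σ := by
          rw [e1, eR, hσdef]
          simp only [smul_sub, smul_add, smul_mul_assoc, mul_smul_comm]; abel
        rw [e3, e2]
        simp only [mul_add, add_mul, mul_sub, sub_mul, mul_one, mul_assoc]
        abel
      rw [main]
      have nR : ‖R‖ ≤ 2 * C * ‖h‖ ^ 2 := by
        have a1 := (A (t • y) - A (t • x) - fderiv ℝ A (t • x) (t • h)).le_of_opNorm_le L2 x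
        have a2 := (A (t • y) - A (t • x)).le_of_opNorm_le L1 h
        calc ‖R‖ ≤ C * ‖t • h‖ ^ 2 * ‖x‖ + C * ‖t • h‖ * ‖h‖ := norm_add_le_of_le a1 a2
          _ ≤ C * ‖h‖ ^ 2 * 1 + C * ‖h‖ * ‖h‖ := by
            gcongr
            exact hx1 hx
          _ = _ := by ring
      have nQ : ‖Q‖ ≤ 2 * C * ‖h‖ := by
        have a1 := (A (t • y) - A (t • x)).le_of_opNorm_le L1 y
        have a2 := (A (t • x)).le_of_opNorm_le hAx h
        calc ‖Q‖ ≤ C * ‖t • h‖ * ‖y‖ + C * ‖h‖ := norm_add_le_of_le a1 a2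
          _ ≤ C * ‖h‖ * 1 + C * ‖h‖ := by
            gcongr
            exact hx1 hy
          _ = _ := by ring
      have nσ : ‖σ‖ ≤ C * ‖h‖ := by
        rw [hσdef, norm_smul, Real.norm_of_nonneg ht.1]
        exact (mul_le_of_le_one_left (norm_nonneg _) ht.2).trans
          ((A (t • x)).le_of_opNorm_le hAx h)
      refine norm_add_le_of_le ?_ ?_
      · refine (norm_mul_le _ _).trans ?_
        rw [mul_comm]
        gcongr
        exact hbound hy t ht
      · calc ‖p x t * (R + σ * Q)‖ ≤ ‖p x t‖ * (‖R‖ + ‖σ‖ * ‖Q‖) :=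
              (norm_mul_le _ _).trans (by
                gcongr
                exact norm_add_le_of_le le_rfl (norm_mul_le _ _))
          _ ≤ 3 * (2 * C * ‖h‖ ^ 2 + C * ‖h‖ * (2 * C * ‖h‖)) := by
            gcongr
            exact pxb t ht
          _ = ε := by rw [hε]; ring
  rw [hasFDerivAt_iff_isLittleO]
  refine Asymptotics.IsBigO.trans_isLittleO (g := fun y ↦ ‖y - x‖ ^ 2) ?_ ?_
  · refine Asymptotics.IsBigO.of_bound (3 * (2 * C + C * (2 * C)) * D) ?_
    filter_upwards [isOpen_ball.mem_nhds hx] with y hy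
    simpa using key y hy
  · have := Asymptotics.isLittleO_norm_pow_id (E' := E) one_lt_two
    have h2 : Tendsto (fun y ↦ y - x) (𝓝 x) (𝓝 0) := by
      have : ContinuousAt (fun y ↦ y - x) x := by fun_prop
      simpa [ContinuousAt] using this
    exact this.comp_tendsto h2

/-- Version of `exists_parallel_at_zero` at an arbitrary base point. -/
lemma exists_parallel (h1 : ‖(1 : 𝔸)‖ ≤ 1) {A : E → E →L[ℝ] 𝔸} {x₀ : E}
    (hA : ContDiffAt ℝ 2 A x₀)
    (hflat : ∀ᶠ u in 𝓝 x₀, ∀ h k : E, fderiv ℝ A u h k + A u h * A u k =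
      fderiv ℝ A u k h + A u k * A u h) :
    ∃ P : E → 𝔸, P x₀ = 1 ∧
      ∀ᶠ x in 𝓝 x₀, HasFDerivAt P ((ContinuousLinearMap.mul ℝ 𝔸 (P x)) ∘L A x) x := by
  have t1 : Tendsto (fun u ↦ x₀ + u) (𝓝 0) (𝓝 x₀) := by
    have : ContinuousAt (fun u : E ↦ x₀ + u) 0 := by fun_prop
    simpa [ContinuousAt] using this
  have t2 : Tendsto (fun u ↦ u - x₀) (𝓝 x₀) (𝓝 0) := by
    have : ContinuousAt (fun u : E ↦ u - x₀) x₀ := by fun_prop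
    simpa [ContinuousAt] using this
  obtain ⟨P, hP0, hP⟩ := exists_parallel_at_zero h1 (A := fun u ↦ A (x₀ + u))
    (by
      have : ContDiffAt ℝ 2 A (x₀ + 0) := by simpa using hA
      exact this.comp (0 : E) (by fun_prop))
    (by
      filter_upwards [t1.eventually hflat] with u hu h k
      simpa [fderiv_comp_add_left] using hu h k)
  refine ⟨fun x ↦ P (x - x₀), by simpa using hP0, ?_⟩
  filter_upwards [t2.eventually hP] with x hx
  have : HasFDerivAt (fun x ↦ P (x - x₀)) _ x := hx.comp x ((hasFDerivAt_id x).sub_const x₀)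
  refine this.congr_fderiv ?_
  ext v
  simp

end Frobenius

section Christoffel

variable {E : Type*} [NormedAddCommGroup E] [NormedSpace ℝ E]

/-- The Koszul form `½ (D h v z + D v h z - D z h v)` of the derivative `D` of a metric. -/
def koszulForm (D : E →L[ℝ] E →L[ℝ] E →L[ℝ] ℝ) : E →L[ℝ] E →L[ℝ] E →L[ℝ] ℝ :=
  (1 / 2 : ℝ) • (D + D.flip -
    (ContinuousLinearMap.flipₗᵢ ℝ E E ℝ : (E →L[ℝ] E →L[ℝ] ℝ) →L[ℝ] (E →L[ℝ] E →L[ℝ] ℝ)) ∘L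
      D.flip)

lemma koszulForm_apply (D : E →L[ℝ] E →L[ℝ] E →L[ℝ] ℝ) (h v z : E) :
    koszulForm D h v z = (D h v z + D v h z - D z h v) / 2 := by
  simp [koszulForm]; ring

lemma contDiff_koszulForm : ContDiff ℝ ∞ (koszulForm (E := E)) := by
  have h1 : ContDiff ℝ ∞ (fun D : E →L[ℝ] E →L[ℝ] E →L[ℝ] ℝ ↦ D.flip) :=
    (ContinuousLinearMap.flipₗᵢ ℝ E E (E →L[ℝ] ℝ)).contDiff
  unfold koszulForm
  exact ContDiff.const_smul (1 / 2 : ℝ)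
    ((contDiff_id.add h1).sub (contDiff_const.clm_comp h1))

/-- The Christoffel symbols of a metric `g` on a vector space: `christoffel g u h v` is the
covariant derivative at `u` of the constant field `v` in the direction `h`. -/
def christoffel (g : E → E →L[ℝ] E →L[ℝ] ℝ) (u : E) : E →L[ℝ] E →L[ℝ] E :=
  (ContinuousLinearMap.compL ℝ E (E →L[ℝ] ℝ) E (g u).inverse) ∘L koszulForm (fderiv ℝ g u)

variable {g : E → E →L[ℝ] E →L[ℝ] ℝ} {s : Set E} {u : E}

lemma metric_christoffel (hg : (g u).IsInvertible) (h v z : E) :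
    g u (christoffel g u h v) z =
      (fderiv ℝ g u h v z + fderiv ℝ g u v h z - fderiv ℝ g u z h v) / 2 := by
  rw [← koszulForm_apply]
  simp [christoffel, hg.self_apply_inverse]

lemma fderiv_metric_symm (hs : IsOpen s) (hg : DifferentiableOn ℝ g s)
    (hsymm : ∀ u ∈ s, ∀ v w, g u v w = g u w v) (hu : u ∈ s) (h v w : E) :
    fderiv ℝ g u h v w = fderiv ℝ g u h w v := by
  have hd := (hg.differentiableAt (hs.mem_nhds hu)).hasFDerivAt
  have key : ∀ v w : E, HasFDerivAt (fun u ↦ g u v w) ((fderiv ℝ g u).flip v |>.flip w) u := by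
    intro v w
    refine ((hd.clm_apply (hasFDerivAt_const v u)).clm_apply (hasFDerivAt_const w u)).congr_fderiv ?_
    ext; simp
  have e := (key v w).unique ((key w v).congr_of_eventuallyEq
    (by filter_upwards [hs.mem_nhds hu] with u hu using hsymm u hu v w))
  exact congr($e h)

lemma christoffel_symm (hs : IsOpen s) (hg : DifferentiableOn ℝ g s)
    (hsymm : ∀ u ∈ s, ∀ v w, g u v w = g u w v) (hu : u ∈ s) (h v : E) :
    christoffel g u h v = christoffel g u v h := by
  simp only [christoffel, ContinuousLinearMap.comp_apply, ContinuousLinearMap.compL_apply]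
  congr 1
  ext z
  rw [koszulForm_apply, koszulForm_apply, fderiv_metric_symm hs hg hsymm hu z]
  ring

lemma fderiv_metric_eq (hs : IsOpen s) (hg : DifferentiableOn ℝ g s)
    (hsymm : ∀ u ∈ s, ∀ v w, g u v w = g u w v) (hu : u ∈ s) (hinv : (g u).IsInvertible)
    (h v w : E) :
    fderiv ℝ g u h v w = g u (christoffel g u h v) w + g u v (christoffel g u h w) := by
  rw [hsymm u hu v, metric_christoffel hinv, metric_christoffel hinv,
    fderiv_metric_symm hs hg hsymm hu h w v, fderiv_metric_symm hs hg hsymm hu w h v,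
    fderiv_metric_symm hs hg hsymm hu v h w]
  ring

/-- The Christoffel symbols are the only symmetric ones compatible with the metric. -/
lemma eq_christoffel (hinv : (g u).IsInvertible) (hsymm : ∀ v w, g u v w = g u w v)
    {N : E → E → E} (hN : ∀ h v, N h v = N v h)
    (hcompat : ∀ h v w, fderiv ℝ g u h v w = g u (N h v) w + g u v (N h w)) (h v : E) :
    N h v = christoffel g u h v := by
  have : g u (N h v) = g u (christoffel g u h v) := by
    ext z
    rw [metric_christoffel hinv, hcompat, hcompat, hcompat, hN v h, hN z h, hN z v,
      hsymm (N h z) v, hsymm h]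
    ring
  rw [← hinv.inverse_apply_self (N h v), this, hinv.inverse_apply_self]

lemma isInvertible_of_posDef [FiniteDimensional ℝ E] {B : E →L[ℝ] E →L[ℝ] ℝ}
    (hB : ∀ v, v ≠ 0 → 0 < B v v) : B.IsInvertible := by
  have hinj : Function.Injective B := by
    rw [injective_iff_map_eq_zero]
    intro v hv
    by_contra hne
    simpa [hv] using hB v hne
  have hdim : Module.finrank ℝ E = Module.finrank ℝ (E →L[ℝ] ℝ) := by
    rw [← (LinearMap.toContinuousLinearMap (𝕜 := ℝ) (E := E) (F' := ℝ)).finrank_eq]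
    exact Subspace.dual_finrank_eq.symm
  exact ⟨(LinearEquiv.ofInjectiveOfFinrankEq (B : E →ₗ[ℝ] E →L[ℝ] ℝ) hinj
    hdim).toContinuousLinearEquiv, rfl⟩

lemma contDiffOn_christoffel [CompleteSpace E] (hs : IsOpen s) (hg : ContDiffOn ℝ ∞ g s)
    (hinv : ∀ u ∈ s, (g u).IsInvertible) : ContDiffOn ℝ ∞ (christoffel g) s := by
  have h1 : ContDiffOn ℝ ∞ (fun u ↦ koszulForm (fderiv ℝ g u)) s :=
    contDiff_koszulForm.comp_contDiffOn (hg.fderiv_of_isOpen hs (by simp))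
  have h2 : ContDiffOn ℝ ∞ (fun u ↦ (g u).inverse) s := by
    intro u hu
    obtain ⟨e, he⟩ := hinv u hu
    have := contDiffAt_map_inverse (n := ∞) e
    rw [he] at this
    exact this.comp_contDiffWithinAt u (hg u hu)
  exact ((ContinuousLinearMap.compL ℝ E (E →L[ℝ] ℝ) E).contDiff.comp_contDiffOn h2).clm_comp h1

end Christoffel

section Flat

variable {E : Type*} [NormedAddCommGroup E] [InnerProductSpace ℝ E] [FiniteDimensional ℝ E]
  {g : E → E →L[ℝ] E →L[ℝ] ℝ} {s : Set E} {x₀ : E}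

/-- A solution of a linear total differential equation with smooth coefficients is smooth. -/
lemma contDiffOn_of_hasFDerivAt_comp (hs : IsOpen s) {A : E → E →L[ℝ] E →L[ℝ] E}
    (hA : ContDiffOn ℝ ∞ A s) {P : E → E →L[ℝ] E}
    (hP : ∀ x ∈ s, HasFDerivAt P (ContinuousLinearMap.compL ℝ E E E (P x) ∘L A x) x) :
    ContDiffOn ℝ ∞ P s := by
  have hd : DifferentiableOn ℝ P s := fun x hx ↦ (hP x hx).differentiableAt.differentiableWithinAt
  have key : ∀ n : ℕ, ContDiffOn ℝ n P s := by
    intro n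
    induction n with
    | zero => exact contDiffOn_zero.2 hd.continuousOn
    | succ n ih =>
      push_cast
      rw [contDiffOn_succ_iff_fderiv_of_isOpen hs]
      refine ⟨hd, by simp, ?_⟩
      refine ContDiffOn.congr (f := fun x ↦ ContinuousLinearMap.compL ℝ E E E (P x) ∘L A x)
        ?_ fun x hx ↦ (hP x hx).fderiv
      exact ((ContinuousLinearMap.compL ℝ E E E).contDiff.comp_contDiffOn ih).clm_comp
        (hA.of_le (mod_cast le_top))
  exact contDiffOn_infty.2 key

/-- A flat metric on an open subset of a Euclidean space is, locally, the pullback of the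
Euclidean metric by a smooth map. -/
theorem exists_isometric_map (hs : IsOpen s) (hx₀ : x₀ ∈ s) (hg : ContDiffOn ℝ ∞ g s)
    (hsymm : ∀ u ∈ s, ∀ v w, g u v w = g u w v) (hpos : ∀ u ∈ s, ∀ v, v ≠ 0 → 0 < g u v v)
    (hflat : ∀ u ∈ s, ∀ h k w : E,
      fderiv ℝ (christoffel g) u h k w + christoffel g u h (christoffel g u k w) =
        fderiv ℝ (christoffel g) u k h w + christoffel g u k (christoffel g u h w))
    {P₀ : E →L[ℝ] E} (hP₀ : ∀ v w, inner ℝ (P₀ v) (P₀ w) = g x₀ v w) :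
    ∃ φ : E → E, ∃ t : Set E, IsOpen t ∧ x₀ ∈ t ∧ t ⊆ s ∧ ContDiffOn ℝ ∞ φ t ∧
      ∀ x ∈ t, ∀ v w, inner ℝ (fderiv ℝ φ x v) (fderiv ℝ φ x w) = g x v w := by
  have hinv : ∀ u ∈ s, (g u).IsInvertible := fun u hu ↦ isInvertible_of_posDef (hpos u hu)
  have hgd : DifferentiableOn ℝ g s := hg.differentiableOn (by simp)
  have hΓ := contDiffOn_christoffel hs hg hinv
  obtain ⟨Q, hQ0, hQ⟩ := exists_parallel (𝔸 := E →L[ℝ] E) (x₀ := x₀)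
    ContinuousLinearMap.norm_id_le
    ((hΓ.contDiffAt (hs.mem_nhds hx₀)).of_le ENat.LEInfty.out) (by
      filter_upwards [hs.mem_nhds hx₀] with u hu h k
      ext w
      exact hflat u hu h k w)
  have hunit : ∀ᶠ x in 𝓝 x₀, IsUnit (Q x) := by
    have hc : ContinuousAt Q x₀ := hQ.self_of_nhds.continuousAt
    exact hc.eventually (Units.isOpen.mem_nhds (by simp [hQ0]))
  obtain ⟨r, hr, hball⟩ := Metric.eventually_nhds_iff_ball.1
    (hQ.and (hunit.and (eventually_mem_set.2 (hs.mem_nhds hx₀))))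
  have hQd : ∀ x ∈ ball x₀ r, HasFDerivAt Q
      ((ContinuousLinearMap.mul ℝ (E →L[ℝ] E) (Q x)) ∘L christoffel g x) x :=
    fun x hx ↦ (hball x hx).1
  have hts : ball x₀ r ⊆ s := fun x hx ↦ (hball x hx).2.2
  have hmetric : ∀ x ∈ ball x₀ r, ∀ v w, inner ℝ (P₀ (Q x v)) (P₀ (Q x w)) = g x v w := by
    intro x hx v w
    set R : E → E →L[ℝ] E := fun x ↦ Ring.inverse (Q x) with hR
    have hRd : ∀ y ∈ ball x₀ r, ∀ v, HasFDerivAt (fun y ↦ R y v)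
        (-(christoffel g y).flip (R y v)) y := by
      intro y hy v
      obtain ⟨a, ha⟩ := (hball y hy).2.1
      have e1 := hasFDerivAt_ringInverse (𝕜 := ℝ) a
      rw [ha] at e1
      have e2 := (e1.comp y (hQd y hy)).clm_apply (hasFDerivAt_const v y)
      refine HasFDerivAt.congr_fderiv e2 ?_
      ext h
      have : R y = ↑a⁻¹ := by rw [hR]; simp [← ha]
      simp only [add_apply, ContinuousLinearMap.comp_apply,
        ContinuousLinearMap.flip_apply, neg_apply,
        ContinuousLinearMap.mulLeftRight_apply, ContinuousLinearMap.mul_apply', ← ha, this,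
        ← mul_assoc, Units.inv_mul, one_mul]
      simp
    have hconst : ∀ v w, g x (R x v) (R x w) = g x₀ (R x₀ v) (R x₀ w) := by
      intro v w
      have hf : ∀ y ∈ ball x₀ r, HasFDerivAt (fun y ↦ g y (R y v) (R y w)) (0 : E →L[ℝ] ℝ) y := by
        intro y hy
        have e := (((hgd.differentiableAt (hs.mem_nhds (hts hy))).hasFDerivAt.clm_apply
          (hRd y hy v)).clm_apply (hRd y hy w))
        refine e.congr_fderiv ?_
        ext h
        simp [fderiv_metric_eq hs hgd hsymm (hts hy) (hinv y (hts hy))]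
      exact (convex_ball x₀ r).is_const_of_fderivWithin_eq_zero (𝕜 := ℝ)
        (fun y hy ↦ (hf y hy).differentiableAt.differentiableWithinAt)
        (fun y hy ↦ by
          rw [fderivWithin_of_isOpen isOpen_ball hy, (hf y hy).fderiv])
        hx (mem_ball_self hr)
    have e1 : ∀ v, R x (Q x v) = v := by
      intro v
      have := Ring.inverse_mul_cancel _ (hball x hx).2.1
      exact congr($this v)
    have e2 : ∀ v, R x₀ v = v := by intro v; simp [hR, hQ0]
    rw [hP₀, ← e1 v, ← e1 w, hconst]
    simp only [e1, e2]
  set P : E → E →L[ℝ] E := fun x ↦ P₀ ∘L Q x with hPdef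
  have hPd : ∀ x ∈ ball x₀ r, HasFDerivAt P
      (ContinuousLinearMap.compL ℝ E E E (P x) ∘L christoffel g x) x := by
    intro x hx
    refine ((hasFDerivAt_const P₀ x).clm_comp (hQd x hx)).congr_fderiv ?_
    ext h v
    simp [hPdef]
  have hPs := contDiffOn_of_hasFDerivAt_comp isOpen_ball (hΓ.mono hts) hPd
  obtain ⟨φ, hφ⟩ := (convex_ball x₀ r).exists_forall_hasFDerivAt_of_fderiv_symmetric isOpen_ball
    (show DifferentiableOn ℝ P (ball x₀ r) from
      fun x hx ↦ (hPd x hx).differentiableAt.differentiableWithinAt) (by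
      intro x hx h k
      simp [(hPd x hx).fderiv, christoffel_symm hs hgd hsymm (hts hx) h k])
  refine ⟨φ, ball x₀ r, isOpen_ball, mem_ball_self hr, hts, ?_, fun x hx v w ↦ ?_⟩
  · rw [contDiffOn_infty_iff_fderiv_of_isOpen isOpen_ball]
    exact ⟨fun x hx ↦ (hφ x hx).differentiableAt.differentiableWithinAt,
      hPs.congr fun x hx ↦ (hφ x hx).fderiv⟩
  · rw [(hφ x hx).fderiv]
    exact hmetric x hx v w

end Flat

section CoordinateFields

variable {E : Type*} [NormedAddCommGroup E] [NormedSpace ℝ E]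
  {H : Type*} [TopologicalSpace H] {I : ModelWithCorners ℝ E H}
  {M : Type*} [TopologicalSpace M] [ChartedSpace H M]

/-- A local homeomorphism from `M` to its model space which is smooth in both directions. -/
structure IsSmoothCoord (I : ModelWithCorners ℝ E H) (e : OpenPartialHomeomorph M E) : Prop where
  contMDiffOn : ContMDiffOn I 𝓘(ℝ, E) ∞ e e.source
  contMDiffOn_symm : ContMDiffOn 𝓘(ℝ, E) I ∞ e.symm e.target

/-- The derivative of local coordinates. -/
def coordDeriv (I : ModelWithCorners ℝ E H) (e : OpenPartialHomeomorph M E) (y : M) :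
    TangentSpace I y →L[ℝ] E := mfderiv I 𝓘(ℝ, E) e y

lemma mdifferentiableAt_vectorField_vectorSpace {V : Π u : E, TangentSpace 𝓘(ℝ, E) u} {u : E}
    (hV : DifferentiableAt ℝ (F := E) V u) : MDiffAt (T% V) u := by
  refine (mdifferentiableAt_totalSpace ..).2 ⟨mdifferentiableAt_id, ?_⟩
  convert! hV.mdifferentiableAt with y
  simp

/-- The vector field on `M` with components `V` in the local coordinates `e`. -/
def coordField (I : ModelWithCorners ℝ E H) (e : OpenPartialHomeomorph M E) (V : E → E) (y : M) :
    TangentSpace I y := (coordDeriv I e y).inverse (V (e y))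

variable {e : OpenPartialHomeomorph M E} {V W : E → E} {y : M}

namespace IsSmoothCoord

lemma contMDiffAt (he : IsSmoothCoord I e) (hy : y ∈ e.source) :
    ContMDiffAt I 𝓘(ℝ, E) ∞ e y :=
  he.contMDiffOn.contMDiffAt (e.open_source.mem_nhds hy)

lemma contMDiffAt_symm (he : IsSmoothCoord I e) {u : E} (hu : u ∈ e.target) :
    ContMDiffAt 𝓘(ℝ, E) I ∞ e.symm u :=
  he.contMDiffOn_symm.contMDiffAt (e.open_target.mem_nhds hu)

lemma mdifferentiable (he : IsSmoothCoord I e) : e.MDifferentiable I 𝓘(ℝ, E) :=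
  ⟨he.contMDiffOn.mdifferentiableOn (by simp), he.contMDiffOn_symm.mdifferentiableOn (by simp)⟩

lemma isInvertible_mfderiv (he : IsSmoothCoord I e) (hy : y ∈ e.source) :
    (mfderiv I 𝓘(ℝ, E) e y).IsInvertible :=
  ⟨he.mdifferentiable.mfderiv hy, rfl⟩

lemma isInvertible (he : IsSmoothCoord I e) (hy : y ∈ e.source) :
    (coordDeriv I e y).IsInvertible := he.isInvertible_mfderiv hy

lemma coordDeriv_coordField (he : IsSmoothCoord I e) (hy : y ∈ e.source) :
    coordDeriv I e y (coordField I e V y) = V (e y) :=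
  (he.isInvertible hy).self_apply_inverse _

lemma coordField_const_coordDeriv (he : IsSmoothCoord I e) (hy : y ∈ e.source)
    (v : TangentSpace I y) : coordField I e (fun _ ↦ coordDeriv I e y v) y = v :=
  (he.isInvertible hy).inverse_apply_self _

end IsSmoothCoord

lemma coordField_congr (h : V (e y) = W (e y)) : coordField I e V y = coordField I e W y := by
  simp [coordField, h]

lemma coordField_eq_mpullback :
    coordField I e V = VectorField.mpullback I 𝓘(ℝ, E) e V := rfl

variable [IsManifold I ∞ M] [CompleteSpace E]

lemma IsSmoothCoord.contMDiffAt_coordField (he : IsSmoothCoord I e) (hy : y ∈ e.source)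
    (hV : ContDiffAt ℝ ∞ V (e y)) : CMDiffAt ∞ (T% (coordField I e V)) y := by
  rw [coordField_eq_mpullback]
  exact ContMDiffAt.mpullback_vectorField_preimage
    (contMDiffAt_vectorSpace_iff_contDiffAt.2 hV) (he.contMDiffAt hy)
    (he.isInvertible_mfderiv hy) (by simp)

lemma IsSmoothCoord.mdifferentiableAt_coordField (he : IsSmoothCoord I e) (hy : y ∈ e.source)
    (hV : DifferentiableAt ℝ V (e y)) : MDiffAt (T% (coordField I e V)) y := by
  rw [coordField_eq_mpullback]
  exact MDifferentiableAt.mpullback_vectorField (mdifferentiableAt_vectorField_vectorSpace hV)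
    (he.contMDiffAt hy) (he.isInvertible_mfderiv hy) ENat.LEInfty.out

lemma IsSmoothCoord.mdifferentiableAt_coordField_const (he : IsSmoothCoord I e)
    (hy : y ∈ e.source) (v : E) : MDiffAt (T% (coordField I e (fun _ ↦ v))) y :=
  he.mdifferentiableAt_coordField hy (differentiableAt_const v)

/-- Every smooth vector field is given by smooth components. -/
lemma IsSmoothCoord.exists_eventuallyEq_coordField (he : IsSmoothCoord I e) (hy : y ∈ e.source)
    {X : Π y : M, TangentSpace I y} (hX : CMDiffAt ∞ (T% X) y) :
    ∃ V : E → E, ContDiffAt ℝ ∞ V (e y) ∧ X =ᶠ[𝓝 y] coordField I e V := by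
  refine ⟨fun u ↦ coordDeriv I e (e.symm u) (X (e.symm u)), ?_, ?_⟩
  · have hu : e y ∈ e.target := e.map_source hy
    have hX' : CMDiffAt ∞ (T% X) (e.symm (e y)) := by rwa [e.left_inv hy]
    have hi : (mfderiv 𝓘(ℝ, E) I e.symm (e y)).IsInvertible :=
      ⟨he.mdifferentiable.symm.mfderiv hu, rfl⟩
    have := ContMDiffAt.mpullback_vectorField_preimage (m := ∞) hX' (he.contMDiffAt_symm hu) hi
      (by simp)
    rw [contMDiffAt_vectorSpace_iff_contDiffAt] at this
    refine this.congr_of_eventuallyEq ?_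
    filter_upwards [e.open_target.mem_nhds hu] with u hu
    have h1 := he.mdifferentiable.comp_symm_deriv hu
    have h2 := he.mdifferentiable.symm.comp_symm_deriv (e.map_target hu)
    have hi : (mfderiv 𝓘(ℝ, E) I e.symm u).IsInvertible :=
      ⟨he.mdifferentiable.symm.mfderiv hu, rfl⟩
    have h3 : ∀ v, coordDeriv I e (e.symm u) (mfderiv 𝓘(ℝ, E) I e.symm u v) = v :=
      fun v ↦ congr($h1 v)
    rw [VectorField.mpullback_apply]
    rw [← h3 ((mfderiv 𝓘(ℝ, E) I e.symm u).inverse (X (e.symm u))), hi.self_apply_inverse]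
  · filter_upwards [e.open_source.mem_nhds hy] with z hz
    rw [coordField, e.left_inv hz]
    exact ((he.isInvertible hz).inverse_apply_self _).symm

lemma IsSmoothCoord.mlieBracket_coordField (he : IsSmoothCoord I e) (hy : y ∈ e.source)
    (hV : ContDiffAt ℝ ∞ V (e y)) (hW : ContDiffAt ℝ ∞ W (e y)) :
    VectorField.mlieBracket I (coordField I e V) (coordField I e W) y =
      coordField I e (fun u ↦ fderiv ℝ W u (V u) - fderiv ℝ V u (W u)) y := by
  have : IsManifold I (minSmoothness ℝ 2) M := by
    rw [minSmoothness_of_isRCLikeNormedField]; infer_instance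
  have key := VectorField.mpullback_mlieBracket (I := I) (I' := 𝓘(ℝ, E)) (f := e) (x₀ := y)
    (V := fun u ↦ (V u : TangentSpace 𝓘(ℝ, E) u)) (W := fun u ↦ (W u : TangentSpace 𝓘(ℝ, E) u))
    ((contMDiffAt_vectorSpace_iff_contDiffAt.2 hV).mdifferentiableAt (by simp))
    ((contMDiffAt_vectorSpace_iff_contDiffAt.2 hW).mdifferentiableAt (by simp))
    (he.contMDiffAt hy) (by rw [minSmoothness_of_isRCLikeNormedField]; exact ENat.LEInfty.out)
  have hb : VectorField.mlieBracket 𝓘(ℝ, E) (fun u ↦ (V u : TangentSpace 𝓘(ℝ, E) u))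
      (fun u ↦ (W u : TangentSpace 𝓘(ℝ, E) u)) (e y) =
      fderiv ℝ W (e y) (V (e y)) - fderiv ℝ V (e y) (W (e y)) := by
    refine (congrFun (VectorField.mlieBracketWithin_eq_lieBracketWithin (s := univ)) (e y)).trans ?_
    rw [VectorField.lieBracketWithin_univ, VectorField.lieBracket]
  exact key.symm.trans (congrArg (mfderiv I 𝓘(ℝ, E) e y).inverse hb)

/-- The chain rule for a function expressed in local coordinates. -/
lemma IsSmoothCoord.mvfderiv_comp_coordField (he : IsSmoothCoord I e) (hy : y ∈ e.source)
    {f : E → ℝ} (hf : DifferentiableAt ℝ f (e y)) (v : TangentSpace I y) :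
    d% (fun z ↦ f (e z)) y v = fderiv ℝ f (e y) (coordDeriv I e y v) := by
  have := mvfderiv_comp_apply y (g := f) (f := e) hf.mdifferentiableAt
    ((he.contMDiffAt hy).mdifferentiableAt (by simp)) v
  refine this.trans ?_
  simp only [mvfderiv, mfderiv_eq_fderiv]
  rfl

end CoordinateFields

section Connection

variable {E : Type*} [NormedAddCommGroup E] [NormedSpace ℝ E] [FiniteDimensional ℝ E]
  {H : Type*} [TopologicalSpace H] {I : ModelWithCorners ℝ E H}
  {M : Type*} [TopologicalSpace M] [ChartedSpace H M] [IsManifold I ∞ M]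
  {e : OpenPartialHomeomorph M E} {V : E → E} {y : M}

lemma cov_sum (cov : CovariantDerivative I E (fun x : M ↦ TangentSpace I x)) {ι : Type*}
    (s : Finset ι) {σ : ι → Π x : M, TangentSpace I x} (hσ : ∀ i, MDiffAt (T% (σ i)) y) :
    cov (fun z ↦ ∑ i ∈ s, σ i z) y = ∑ i ∈ s, cov (σ i) y := by
  classical
  induction s using Finset.induction_on with
  | empty => simp only [Finset.sum_empty]; exact cov.isCovariantDerivativeOn.zero
  | insert i s hi ih =>
    simp only [Finset.sum_insert hi]
    rw [← ih]
    exact cov.isCovariantDerivativeOn.add (hσ i) (MDifferentiableAt.sum_section fun i _ ↦ hσ i)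

lemma cov_congr (cov : CovariantDerivative I E (fun x : M ↦ TangentSpace I x))
    {X Y : Π x : M, TangentSpace I x} (hY : MDiffAt (T% Y) y) (h : X =ᶠ[𝓝 y] Y) :
    cov X y = cov Y y := by
  refine cov.isCovariantDerivativeOn.congr_of_eventuallyEq ?_ hY univ_mem h
  refine hY.congr_of_eventuallyEq ?_
  filter_upwards [h] with z hz
  simp [hz]

/-- The covariant derivative in local coordinates, in terms of its values on constant fields. -/
lemma cov_coordField (cov : CovariantDerivative I E (fun x : M ↦ TangentSpace I x))
    (he : IsSmoothCoord I e) (hy : y ∈ e.source) (hVd : DifferentiableAt ℝ V (e y))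
    (w : TangentSpace I y) :
    cov (coordField I e V) y w =
      coordField I e (fun _ ↦ fderiv ℝ V (e y) (coordDeriv I e y w)) y +
        cov (coordField I e (fun _ ↦ V (e y))) y w := by
  set b := Module.finBasis ℝ E
  have hc : ∀ i, MDiffAt (T% (coordField I e (fun _ ↦ b i))) y := fun i ↦
    he.mdifferentiableAt_coordField_const hy (b i)
  set c : Fin (Module.finrank ℝ E) → E →L[ℝ] ℝ := fun i ↦
    LinearMap.toContinuousLinearMap (b.coord i)
  have hsum : ∀ v : E, v = ∑ i, c i v • b i := fun v ↦ (b.sum_repr v).symm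
  have hfd : ∀ i, DifferentiableAt ℝ (fun u ↦ c i (V u)) (e y) := fun i ↦
    (c i).differentiableAt.comp _ hVd
  have hf : ∀ i, MDiffAt (fun z ↦ c i (V (e z))) y := fun i ↦
    (hfd i).mdifferentiableAt.comp y ((he.contMDiffAt hy).mdifferentiableAt (by simp))
  have h1 : coordField I e V =
      fun z ↦ ∑ i, ((fun z ↦ c i (V (e z))) • coordField I e (fun _ ↦ b i)) z := by
    funext z
    conv_lhs => rw [coordField, hsum (V (e z))]
    simp [coordField]
  have h2 : coordField I e (fun _ ↦ V (e y)) =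
      fun z ↦ ∑ i, ((c i (V (e y))) • coordField I e (fun _ ↦ b i)) z := by
    funext z
    conv_lhs => rw [coordField, hsum (V (e y))]
    simp [coordField]
  have h3 : coordField I e (fun _ ↦ fderiv ℝ V (e y) (coordDeriv I e y w)) y =
      ∑ i, c i (fderiv ℝ V (e y) (coordDeriv I e y w)) • coordField I e (fun _ ↦ b i) y := by
    conv_lhs => rw [coordField, hsum (fderiv ℝ V (e y) (coordDeriv I e y w))]
    simp [coordField]
  rw [h1, h2, h3, cov_sum _ _ (fun i ↦ (hf i).smul_section (hc i)),
    cov_sum _ _ (fun i ↦ (hc i).smul_const_section)]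
  simp only [sum_apply]
  rw [← Finset.sum_add_distrib]
  refine Finset.sum_congr rfl fun i _ ↦ ?_
  rw [cov.isCovariantDerivativeOn.leibniz (hc i) (hf i),
    cov.isCovariantDerivativeOn.smul_const _ (hc i)]
  rw [add_apply, ContinuousLinearMap.smulRight_apply, he.mvfderiv_comp_coordField hy (hfd i)]
  have : fderiv ℝ (fun u ↦ c i (V u)) (e y) = (c i) ∘L fderiv ℝ V (e y) :=
    ((c i).hasFDerivAt.comp _ hVd.hasFDerivAt).fderiv
  rw [this, add_comm]
  rfl

end Connection

section Gram

variable {E : Type*} [NormedAddCommGroup E] [NormedSpace ℝ E] [FiniteDimensional ℝ E]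
  {H : Type*} [TopologicalSpace H] {I : ModelWithCorners ℝ E H}
  {M : Type*} [TopologicalSpace M] [ChartedSpace H M]
  [RiemannianBundle (fun x : M ↦ TangentSpace I x)]

/-- The Riemannian metric in the local coordinates `e`. -/
def gram (I : ModelWithCorners ℝ E H) [RiemannianBundle (fun x : M ↦ TangentSpace I x)]
    (e : OpenPartialHomeomorph M E) (u : E) : E →L[ℝ] E →L[ℝ] ℝ :=
  LinearMap.toContinuousLinearMap
    { toFun v := LinearMap.toContinuousLinearMap
        { toFun w := inner ℝ ((coordDeriv I e (e.symm u)).inverse v)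
            ((coordDeriv I e (e.symm u)).inverse w)
          map_add' := by simp [inner_add_right]
          map_smul' := by simp [inner_smul_right] }
      map_add' := by intro v w; ext; simp [inner_add_left]
      map_smul' := by intro c v; ext; simp [inner_smul_left] }

variable {e : OpenPartialHomeomorph M E} {V W : E → E} {y : M} {u : E}

lemma gram_apply (v w : E) : gram I e u v w =
    inner ℝ ((coordDeriv I e (e.symm u)).inverse v) ((coordDeriv I e (e.symm u)).inverse w) := rfl

lemma inner_coordField (hy : y ∈ e.source) :
    inner ℝ (coordField I e V y) (coordField I e W y) = gram I e (e y) (V (e y)) (W (e y)) := by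
  rw [gram_apply, e.left_inv hy]
  rfl

lemma gram_symm (v w : E) : gram I e u v w = gram I e u w v := by
  rw [gram_apply, gram_apply, real_inner_comm]

lemma IsSmoothCoord.gram_coordDeriv (he : IsSmoothCoord I e) (hy : y ∈ e.source)
    (v w : TangentSpace I y) :
    gram I e (e y) (coordDeriv I e y v) (coordDeriv I e y w) = inner ℝ v w := by
  rw [← inner_coordField (V := fun _ ↦ coordDeriv I e y v) (W := fun _ ↦ coordDeriv I e y w) hy,
    he.coordField_const_coordDeriv hy, he.coordField_const_coordDeriv hy]

lemma IsSmoothCoord.gram_pos (he : IsSmoothCoord I e) (hu : u ∈ e.target) {v : E} (hv : v ≠ 0) :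
    0 < gram I e u v v := by
  rw [gram_apply]
  refine real_inner_self_pos.2 fun h ↦ hv ?_
  rw [← (he.isInvertible (e.map_target hu)).self_apply_inverse v, h, map_zero]

variable [IsManifold I ∞ M] [IsContMDiffRiemannianBundle I ∞ E (fun x : M ↦ TangentSpace I x)]

lemma IsSmoothCoord.contDiffOn_gram (he : IsSmoothCoord I e) :
    ContDiffOn ℝ ∞ (gram I e) e.target := by
  refine contDiffOn_clm_apply.2 fun v ↦ contDiffOn_clm_apply.2 fun w ↦ ?_
  rw [← contMDiffOn_iff_contDiffOn]
  have hf : ContMDiffOn I 𝓘(ℝ, ℝ) ∞ (fun y ↦ (inner ℝ (coordField I e (fun _ ↦ v) y)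
      (coordField I e (fun _ ↦ w) y) : ℝ)) e.source := by
    have h : ∀ v : E, CMDiff[e.source] ∞ (T% (coordField I e (fun _ ↦ v))) := fun v y hy ↦
      (he.contMDiffAt_coordField hy contDiffAt_const).contMDiffWithinAt
    exact ContMDiffOn.inner_bundle (F := E) (E := fun x : M ↦ TangentSpace I x) (b := id)
      (h v) (h w)
  refine (hf.comp he.contMDiffOn_symm e.mapsTo_symm).congr fun u hu ↦ ?_
  simp only [Function.comp]
  rw [inner_coordField (e.map_target hu), e.right_inv hu]

variable {cov : CovariantDerivative I E (fun x : M ↦ TangentSpace I x)}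

/-- The Levi-Civita connection in local coordinates, on constant fields. -/
lemma IsLeviCivita.cov_coordField_const (hcov : IsLeviCivita cov) (he : IsSmoothCoord I e)
    (hy : y ∈ e.source) (h w : E) :
    cov (coordField I e (fun _ ↦ w)) y (coordField I e (fun _ ↦ h) y) =
      coordField I e (fun _ ↦ christoffel (gram I e) (e y) h w) y := by
  have hu := e.map_source hy
  have hd : ∀ v : E, MDiffAt (T% (coordField I e (fun _ ↦ v))) y := fun v ↦
    he.mdifferentiableAt_coordField_const hy v
  set N : E → E → E := fun h w ↦
    coordDeriv I e y (cov (coordField I e (fun _ ↦ w)) y (coordField I e (fun _ ↦ h) y)) with hN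
  have hNc : ∀ h w, cov (coordField I e (fun _ ↦ w)) y (coordField I e (fun _ ↦ h) y) =
      coordField I e (fun _ ↦ N h w) y := fun h w ↦
    (he.coordField_const_coordDeriv hy _).symm
  have hgd : DifferentiableAt ℝ (gram I e) (e y) :=
    (he.contDiffOn_gram.differentiableOn (by simp)).differentiableAt (e.open_target.mem_nhds hu)
  rw [hNc]
  refine coordField_congr ?_
  refine eq_christoffel (isInvertible_of_posDef fun v hv ↦ he.gram_pos hu hv) gram_symm
    (fun h v ↦ ?_) (fun h v w ↦ ?_) h w
  · have := cov.torsion_eq_zero_iff.1 hcov.2 (hd h) (hd v)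
    rw [he.mlieBracket_coordField hy contDiffAt_const contDiffAt_const] at this
    simp only [fderiv_fun_const, Pi.zero_apply, zero_apply, sub_self] at this
    have h0 : coordField I e (fun _ ↦ (0 : E)) y = 0 := by simp [coordField]
    rw [h0, sub_eq_zero] at this
    simp only [hN, this]
  · have key := hcov.1 (coordField I e (fun _ ↦ h)) _ _ y (hd h) (hd v) (hd w)
    rw [hNc, hNc, inner_coordField hy, inner_coordField hy] at key
    rw [← key]
    have hfd : HasFDerivAt (fun u ↦ gram I e u v w)
        ((fderiv ℝ (gram I e) (e y)).flip v |>.flip w) (e y) := by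
      refine ((hgd.hasFDerivAt.clm_apply (hasFDerivAt_const v (e y))).clm_apply
        (hasFDerivAt_const w (e y))).congr_fderiv ?_
      ext; simp
    have e1 : d% (fun z ↦ (inner ℝ (coordField I e (fun _ ↦ v) z)
        (coordField I e (fun _ ↦ w) z) : ℝ)) y = d% (fun z ↦ gram I e (e z) v w) y := by
      have : (fun z ↦ (inner ℝ (coordField I e (fun _ ↦ v) z)
        (coordField I e (fun _ ↦ w) z) : ℝ)) =ᶠ[𝓝 y] (fun z ↦ gram I e (e z) v w) := by
        filter_upwards [e.open_source.mem_nhds hy] with z hz using inner_coordField hz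
      simp only [mvfderiv, this.mfderiv_eq]
      rfl
    rw [e1, he.mvfderiv_comp_coordField hy hfd.differentiableAt, hfd.fderiv,
      he.coordDeriv_coordField hy]
    rfl

/-- The covariant derivative of the field with components `W` along the one with components `V`. -/
def nabla (g : E → E →L[ℝ] E →L[ℝ] ℝ) (V W : E → E) (u : E) : E :=
  fderiv ℝ W u (V u) + christoffel g u (V u) (W u)

/-- The Levi-Civita connection in local coordinates. -/
lemma IsLeviCivita.cov_coordField (hcov : IsLeviCivita cov) (he : IsSmoothCoord I e)
    (hy : y ∈ e.source) (hW : DifferentiableAt ℝ W (e y)) :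
    cov (coordField I e W) y (coordField I e V y) =
      coordField I e (nabla (gram I e) V W) y := by
  rw [RiemannianFlatness.cov_coordField cov he hy hW, he.coordDeriv_coordField hy,
    coordField_congr (V := V) (W := fun _ ↦ V (e y)) rfl, hcov.cov_coordField_const he hy]
  simp [coordField, nabla]

lemma IsSmoothCoord.contDiffAt_christoffel (he : IsSmoothCoord I e) (hu : u ∈ e.target) :
    ContDiffAt ℝ ∞ (christoffel (gram I e)) u :=
  (contDiffOn_christoffel e.open_target he.contDiffOn_gram fun _ hu ↦
    isInvertible_of_posDef fun _ hv ↦ he.gram_pos hu hv).contDiffAt (e.open_target.mem_nhds hu)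

lemma IsSmoothCoord.contDiffAt_nabla (he : IsSmoothCoord I e) (hu : u ∈ e.target)
    (hV : ContDiffAt ℝ ∞ V u) (hW : ContDiffAt ℝ ∞ W u) :
    ContDiffAt ℝ ∞ (nabla (gram I e) V W) u :=
  ((hW.fderiv_right (by simp)).clm_apply hV).add
    (((he.contDiffAt_christoffel hu).clm_apply hV).clm_apply hW)

/-- The curvature in local coordinates. -/
lemma IsLeviCivita.curvature_eq (hcov : IsLeviCivita cov) (he : IsSmoothCoord I e)
    (hy : y ∈ e.source) {U : E → E} (hU : ContDiffAt ℝ ∞ U (e y)) (hV : ContDiffAt ℝ ∞ V (e y))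
    (hW : ContDiffAt ℝ ∞ W (e y)) {X Y Z : Π y : M, TangentSpace I y}
    (hX : X =ᶠ[𝓝 y] coordField I e U) (hY : Y =ᶠ[𝓝 y] coordField I e V)
    (hZ : Z =ᶠ[𝓝 y] coordField I e W) :
    curvature cov X Y Z y =
      coordField I e (nabla (gram I e) U (nabla (gram I e) V W) -
        nabla (gram I e) V (nabla (gram I e) U W) -
        nabla (gram I e) (fun u ↦ fderiv ℝ V u (U u) - fderiv ℝ U u (V u)) W) y := by
  have hu := e.map_source hy
  have hcW : ∀ {z}, z ∈ e.source → DifferentiableAt ℝ W (e z) → Z =ᶠ[𝓝 z] coordField I e W →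
      ∀ V, cov Z z (coordField I e V z) = coordField I e (nabla (gram I e) V W) z := by
    intro z hz hWz hZz V
    rw [cov_congr cov (he.mdifferentiableAt_coordField hz hWz) hZz,
      hcov.cov_coordField he hz hWz]
  have hev : ∀ {V : E → E} {Y : Π y : M, TangentSpace I y}, Y =ᶠ[𝓝 y] coordField I e V →
      (fun z ↦ cov Z z (Y z)) =ᶠ[𝓝 y] coordField I e (nabla (gram I e) V W) := by
    intro V Y hY
    have h1 : ∀ᶠ u in 𝓝 (e y), DifferentiableAt ℝ W u :=
      ((hW.of_le (m := 1) ENat.LEInfty.out).eventually (by simp)).mono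
        fun u hu ↦ hu.differentiableAt (by simp)
    filter_upwards [(he.contMDiffAt hy).continuousAt.eventually h1, e.open_source.mem_nhds hy,
      hZ.eventuallyEq_nhds, hY] with z hz hzs hZz hYz
    rw [hYz, hcW hzs hz hZz]
  have hcc : ∀ {V V' : E → E} {Y Y' : Π y : M, TangentSpace I y}, ContDiffAt ℝ ∞ V (e y) →
      Y =ᶠ[𝓝 y] coordField I e V → Y' =ᶠ[𝓝 y] coordField I e V' →
      cov (fun z ↦ cov Z z (Y z)) y (Y' y) =
        coordField I e (nabla (gram I e) V' (nabla (gram I e) V W)) y := by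
    intro V V' Y Y' hV hY hY'
    have hn := he.contDiffAt_nabla hu hV hW
    rw [cov_congr cov ((he.contMDiffAt_coordField hy hn).mdifferentiableAt (by simp)) (hev hY),
      hY'.self_of_nhds, hcov.cov_coordField he hy (hn.differentiableAt (by simp))]
  rw [curvature, hcc hV hY hX, hcc hU hX hY, hX.mlieBracket_vectorField_eq hY,
    he.mlieBracket_coordField hy hU hV, hcW hy (hW.differentiableAt (by simp)) hZ]
  simp [coordField]

/-- If the curvature vanishes then so does its expression in terms of Christoffel symbols. -/
lemma CurvatureVanishes.christoffel_flat (hflat : CurvatureVanishes cov) (hcov : IsLeviCivita cov)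
    (he : IsSmoothCoord I e) (hu : u ∈ e.target) (h k w : E) :
    fderiv ℝ (christoffel (gram I e)) u h k w +
        christoffel (gram I e) u h (christoffel (gram I e) u k w) =
      fderiv ℝ (christoffel (gram I e)) u k h w +
        christoffel (gram I e) u k (christoffel (gram I e) u h w) := by
  obtain ⟨y, hy, rfl⟩ : ∃ y ∈ e.source, e y = u := ⟨e.symm u, e.map_target hu, e.right_inv hu⟩
  have hs : ∀ v : E, CMDiffAt ∞ (T% (coordField I e (fun _ ↦ v))) y := fun v ↦
    he.contMDiffAt_coordField hy contDiffAt_const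
  have h0 := hflat y _ _ _ (hs h) (hs k) (hs w)
  rw [hcov.curvature_eq he hy contDiffAt_const contDiffAt_const contDiffAt_const
    .rfl .rfl .rfl] at h0
  have h1 := congrArg (coordDeriv I e y) h0
  rw [he.coordDeriv_coordField hy, map_zero] at h1
  have hn : ∀ k : E, nabla (gram I e) (fun _ ↦ k) (fun _ ↦ w) =
      fun u ↦ christoffel (gram I e) u k w := by
    intro k; funext u; simp [nabla]
  have hΓ := (he.contDiffAt_christoffel hu).differentiableAt (by simp)
  have hd : ∀ h k : E, fderiv ℝ (fun u ↦ christoffel (gram I e) u k w) (e y) h =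
      fderiv ℝ (christoffel (gram I e)) (e y) h k w := by
    intro h k
    rw [((hΓ.hasFDerivAt.clm_apply (hasFDerivAt_const k (e y))).clm_apply
        (hasFDerivAt_const w (e y))).fderiv]
    simp
  simp only [hn, Pi.sub_apply] at h1
  simp only [nabla, hd, fderiv_fun_const, Pi.zero_apply, zero_apply, sub_self, map_zero, add_zero,
    sub_zero] at h1
  exact sub_eq_zero.1 h1

end Gram

section Flatness

variable {E : Type*} [NormedAddCommGroup E] [InnerProductSpace ℝ E] [FiniteDimensional ℝ E]
  {H : Type*} [TopologicalSpace H] {I : ModelWithCorners ℝ E H}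
  {M : Type*} [TopologicalSpace M] [ChartedSpace H M] [IsManifold I ∞ M]
  [RiemannianBundle (fun x : M ↦ TangentSpace I x)]
  [IsContMDiffRiemannianBundle I ∞ E (fun x : M ↦ TangentSpace I x)]
  {cov : CovariantDerivative I E (fun x : M ↦ TangentSpace I x)}

/-- A manifold which is locally isometric to a Euclidean space is flat. -/
theorem IsLeviCivita.curvatureVanishes (hcov : IsLeviCivita cov)
    (h : IsLocallyIsometricTo I M 𝓘(ℝ, E) E) : CurvatureVanishes cov := by
  intro x X Y Z hX hY hZ
  obtain ⟨e, hx, he1, he2, hiso⟩ := h x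
  have he : IsSmoothCoord I e := ⟨he1, he2⟩
  have hu := e.map_source hx
  have hgram : ∀ u ∈ e.target, gram I e u = innerSL ℝ := by
    intro u hu
    ext v w
    have hi := he.isInvertible (e.map_target hu)
    rw [gram_apply, ← hiso _ (e.map_target hu)]
    exact congrArg₂ (inner ℝ (E := E)) (hi.self_apply_inverse v) (hi.self_apply_inverse w)
  have hΓ : ∀ u ∈ e.target, christoffel (gram I e) u = 0 := by
    intro u hu
    have : gram I e =ᶠ[𝓝 u] fun _ ↦ innerSL ℝ := by
      filter_upwards [e.open_target.mem_nhds hu] with u hu using hgram u hu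
    ext h v
    simp only [christoffel, ContinuousLinearMap.comp_apply, ContinuousLinearMap.compL_apply]
    have h0 : koszulForm (fderiv ℝ (gram I e) u) h v = 0 := by
      ext z
      rw [koszulForm_apply, this.fderiv_eq]
      simp
    rw [h0]
    simp
  have hnabla : ∀ u ∈ e.target, ∀ V W : E → E, nabla (gram I e) V W u = fderiv ℝ W u (V u) := by
    intro u hu V W
    simp [nabla, hΓ u hu]
  obtain ⟨U, hU, hXU⟩ := he.exists_eventuallyEq_coordField hx hX
  obtain ⟨V, hV, hYV⟩ := he.exists_eventuallyEq_coordField hx hY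
  obtain ⟨W, hW, hZW⟩ := he.exists_eventuallyEq_coordField hx hZ
  rw [hcov.curvature_eq he hx hU hV hW hXU hYV hZW]
  have hWd : DifferentiableAt ℝ (fderiv ℝ W) (e x) :=
    (hW.fderiv_right (m := 1) (by rw [one_add_one_eq_two]; exact ENat.LEInfty.out)).differentiableAt
      (by simp)
  have hiter : ∀ U V : E → E, DifferentiableAt ℝ V (e x) →
      nabla (gram I e) U (nabla (gram I e) V W) (e x) =
        fderiv ℝ (fderiv ℝ W) (e x) (U (e x)) (V (e x)) +
          fderiv ℝ W (e x) (fderiv ℝ V (e x) (U (e x))) := by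
    intro U V hV
    have h1 : nabla (gram I e) V W =ᶠ[𝓝 (e x)] fun u ↦ fderiv ℝ W u (V u) := by
      filter_upwards [e.open_target.mem_nhds hu] with u hu using hnabla u hu V W
    rw [hnabla _ hu, h1.fderiv_eq, (hWd.hasFDerivAt.clm_apply hV.hasFDerivAt).fderiv]
    simp [add_comm]
  have hsymm : IsSymmSndFDerivAt ℝ W (e x) := hW.isSymmSndFDerivAt (by
    rw [minSmoothness_of_isRCLikeNormedField]; exact ENat.LEInfty.out)
  have hzero : (nabla (gram I e) U (nabla (gram I e) V W) -
      nabla (gram I e) V (nabla (gram I e) U W) -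
      nabla (gram I e) (fun u ↦ fderiv ℝ V u (U u) - fderiv ℝ U u (V u)) W) (e x) = 0 := by
    simp only [Pi.sub_apply]
    rw [hiter U V (hV.differentiableAt (by simp)), hiter V U (hU.differentiableAt (by simp)),
      hnabla _ hu, hsymm.eq (U (e x)) (V (e x)), map_sub]
    abel
  rw [coordField, hzero, map_zero]

lemma exists_gram_eq_inner (e : OpenPartialHomeomorph M E) (u : E) :
    ∃ P : E →L[ℝ] E, ∀ v w, inner ℝ (P v) (P w) = gram I e u v w := by
  have : FiniteDimensional ℝ (TangentSpace I (e.symm u)) := inferInstanceAs (FiniteDimensional ℝ E)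
  have hdim : Module.finrank ℝ (TangentSpace I (e.symm u)) = Module.finrank ℝ E := rfl
  let L : TangentSpace I (e.symm u) ≃ₗᵢ[ℝ] E :=
    (stdOrthonormalBasis ℝ (TangentSpace I (e.symm u))).equiv (stdOrthonormalBasis ℝ E)
      (finCongr hdim)
  refine ⟨LinearMap.toContinuousLinearMap
    (L.toLinearEquiv.toLinearMap ∘ₗ ((coordDeriv I e (e.symm u)).inverse : E →ₗ[ℝ] _)), ?_⟩
  intro v w
  exact L.inner_map_map _ _

/-- A smooth map with invertible derivatives is, locally, a diffeomorphism. -/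
lemma exists_smooth_openPartialHomeomorph {φ : E → E} {t : Set E} (ht : IsOpen t) {x₀ : E}
    (hx₀ : x₀ ∈ t) (hφ : ContDiffOn ℝ ∞ φ t) (hinj : ∀ x ∈ t, Function.Injective (fderiv ℝ φ x)) :
    ∃ ψ : OpenPartialHomeomorph E E, x₀ ∈ ψ.source ∧ ψ.source ⊆ t ∧ (∀ x, ψ x = φ x) ∧
      ContDiffOn ℝ ∞ ψ.symm ψ.target := by
  have hequiv : ∀ x ∈ t, ∃ f' : E ≃L[ℝ] E, HasFDerivAt φ (f' : E →L[ℝ] E) x := by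
    intro x hx
    refine ⟨(LinearEquiv.ofInjectiveEndo (fderiv ℝ φ x : E →ₗ[ℝ] E)
      (hinj x hx)).toContinuousLinearEquiv, ?_⟩
    exact ((hφ.contDiffAt (ht.mem_nhds hx)).differentiableAt (by simp)).hasFDerivAt
  obtain ⟨f₀, hf₀⟩ := hequiv x₀ hx₀
  have hc := hφ.contDiffAt (ht.mem_nhds hx₀)
  set ψ := (hc.toOpenPartialHomeomorph φ hf₀ (by simp)).restrOpen t ht with hψ
  have hsub : ψ.source ⊆ t := by
    rw [hψ, OpenPartialHomeomorph.restrOpen_source]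
    exact inter_subset_right
  refine ⟨ψ, ⟨hc.mem_toOpenPartialHomeomorph_source hf₀ (by simp), hx₀⟩, hsub, fun _ ↦ rfl, ?_⟩
  intro u hu
  have hm := hsub (ψ.map_target hu)
  obtain ⟨f', hf'⟩ := hequiv _ hm
  exact (ψ.contDiffAt_symm hu hf' (hφ.contDiffAt (ht.mem_nhds hm))).contDiffWithinAt

end Flatness

section ModelSpace

variable {E : Type*} [NormedAddCommGroup E] [InnerProductSpace ℝ E] [FiniteDimensional ℝ E]
  {M : Type*} [TopologicalSpace M] [ChartedSpace E M] [IsManifold 𝓘(ℝ, E) ∞ M]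
  [RiemannianBundle (fun x : M ↦ TangentSpace 𝓘(ℝ, E) x)]
  [IsContMDiffRiemannianBundle 𝓘(ℝ, E) ∞ E (fun x : M ↦ TangentSpace 𝓘(ℝ, E) x)]
  {cov : CovariantDerivative 𝓘(ℝ, E) E (fun x : M ↦ TangentSpace 𝓘(ℝ, E) x)}

/-- A flat manifold is locally isometric to a Euclidean space. -/
theorem IsLeviCivita.isLocallyIsometricTo (hcov : IsLeviCivita cov)
    (hflat : CurvatureVanishes cov) : IsLocallyIsometricTo 𝓘(ℝ, E) M 𝓘(ℝ, E) E := by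
  intro x
  set e := chartAt E x
  have he : IsSmoothCoord 𝓘(ℝ, E) e := ⟨contMDiffOn_chart, contMDiffOn_chart_symm⟩
  have hx : x ∈ e.source := mem_chart_source E x
  obtain ⟨P, hP⟩ := exists_gram_eq_inner (I := 𝓘(ℝ, E)) e (e x)
  obtain ⟨φ, t, ht, hxt, hts, hφ, hφg⟩ := exists_isometric_map e.open_target (e.map_source hx)
    he.contDiffOn_gram (fun u _ ↦ gram_symm) (fun u hu v hv ↦ he.gram_pos hu hv)
    (fun u hu ↦ hflat.christoffel_flat hcov he hu) hP
  obtain ⟨ψ, hxψ, hψt, hψφ, hψs⟩ := exists_smooth_openPartialHomeomorph ht hxt hφ (by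
    intro u hu
    rw [injective_iff_map_eq_zero]
    intro v hv
    by_contra hne
    have h1 := he.gram_pos (hts hu) hne
    rw [← hφg u hu, hv] at h1
    simp at h1)
  have hψ : ContMDiffOn 𝓘(ℝ, E) 𝓘(ℝ, E) ∞ ψ ψ.source :=
    ((hφ.mono hψt).congr fun u _ ↦ hψφ u).contMDiffOn
  refine ⟨e.trans ψ, by simpa [hx] using hxψ, ?_, ?_, fun y hy v w ↦ ?_⟩
  · rw [OpenPartialHomeomorph.coe_trans, OpenPartialHomeomorph.trans_source]
    exact hψ.comp (he.contMDiffOn.mono inter_subset_left) fun y hy ↦ hy.2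
  · rw [OpenPartialHomeomorph.coe_trans_symm, OpenPartialHomeomorph.trans_target]
    exact he.contMDiffOn_symm.comp (hψs.contMDiffOn.mono inter_subset_left) fun y hy ↦ hy.2
  · rw [OpenPartialHomeomorph.trans_source] at hy
    have hye : y ∈ e.source := hy.1
    have hyt : e y ∈ t := hψt hy.2
    have hd : ∀ v : TangentSpace 𝓘(ℝ, E) y, mfderiv 𝓘(ℝ, E) 𝓘(ℝ, E) (e.trans ψ) y v =
        fderiv ℝ φ (e y) (coordDeriv 𝓘(ℝ, E) e y v) := by
      intro v
      have h1 : MDifferentiableAt 𝓘(ℝ, E) 𝓘(ℝ, E) φ (e y) :=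
        ((hφ.contDiffAt (ht.mem_nhds hyt)).differentiableAt (by simp)).mdifferentiableAt
      have h2 := mfderiv_comp_apply y h1 ((he.contMDiffAt hye).mdifferentiableAt (by simp)) v
      rw [mfderiv_eq_fderiv] at h2
      have h3 : (e.trans ψ : M → E) = φ ∘ e := funext fun z ↦ hψφ (e z)
      rw [h3]
      exact h2
    rw [← he.gram_coordDeriv hye, ← hφg _ hyt]
    exact congrArg₂ (inner ℝ (E := E)) (hd v) (hd w)

end ModelSpace

end RiemannianFlatness

end

theorem mainTheorem2 (n : ℕ) {M : Type*} [TopologicalSpace M]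
    [ChartedSpace (EuclideanSpace ℝ (Fin n)) M] [IsManifold (𝓡 n) ∞ M]
    [RiemannianBundle (fun x : M ↦ TangentSpace (𝓡 n) x)]
    [IsContMDiffRiemannianBundle (𝓡 n) ∞ (EuclideanSpace ℝ (Fin n))
      (fun x : M ↦ TangentSpace (𝓡 n) x)] :
    RiemannianFlatness.IsLocallyIsometricTo (𝓡 n) M (𝓡 n) (EuclideanSpace ℝ (Fin n)) ↔
      RiemannianFlatness.CurvatureVanishes (RiemannianFlatness.leviCivita (𝓡 n) M) :=
  ⟨(RiemannianFlatness.isLeviCivita_leviCivita (𝓡 n) M).curvatureVanishes,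
    (RiemannianFlatness.isLeviCivita_leviCivita (𝓡 n) M).isLocallyIsometricTo⟩
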